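/- Let $\alpha,\beta>0$ and let $L\ge 1$ be an integer. Let $\mathcal V$ be the set of real sequences $v=(v(k))_{k\ge 0}$ with $v(0)=1$, $v(k)\ge v(k+1)$ for all $k\ge 0$ and $\lim_{k\to\infty}v(k)=0$. For $v\in\mathcal V$ put $$F_+(v)(k)=\alpha\bigl(v(k-1)^L-v(k)^L\bigr),\qquad F_-(v)(k)=\beta\bigl(v(k)-v(k+1)\bigr)\qquad(k\ge 1),$$ $F_\pm(v)(0)=0$, and $F=F_+-F_-$. Let $w=(w(k))_{k\ge 1}$ be a sequence of positive reals for which there are constants $c,d>0$ such that $c\,w(k+1)\le w(k)\le d\,w(k+1)$ for all $k\ge 1$. Let $L_2(w)$ be the Hilbert space of real sequences $x=(x(k))_{k\ge 0}$ with $x(0)=0$ and $\|x\|_{L_2(w)}^2=\sum_{k\ge 1}x(k)^2w(k)^{-1}<\infty$. Let $u=(u_t)_{t\ge 0}$ be the solution with values in $\mathcal V$ of $\dot u_t(k)=F(u_t)(k)$ ($k\ge 1$, $t\ge 0$), with initial value $u_0\in\mathcal V$ such that $\sum_{k\ge 1}u_0(k)\,w(k)^{-1}<\infty$. Let $M=(M(k))_{k\ge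 0}$ be a family of independent real continuous centered Gaussian martingales, null at time $0$, with deterministic Doob--Meyer brackets $$\langle M(k)\rangle_t=\int_0^t\bigl\{F_+(u_s)(k)+F_-(u_s)(k)\bigr\}\,ds,\qquad t\ge 0 .$$ Then $M$ is a square-integrable martingale in $L_2(w)$: almost surely $M_t\in L_2(w)$ for all $t\ge 0$; up to modification on a null set, $M$ is an $L_2(w)$-valued martingale with respect to the filtration generated by $M$; and $\mathbf E\bigl(\|M_t\|_{L_2(w)}^2\bigr)<\infty$ for every $t\ge 0$. -/

import Mathlib

open MeasureTheory ProbabilityTheory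
open scoped NNReal ENNReal

noncomputable section

/-- The set `𝒱` of tails of probability measures on `ℕ`: nonincreasing real sequences
with `v 0 = 1` and limit `0`. -/
def TailSeq : Set (ℕ → ℝ) :=
  {v | v 0 = 1 ∧ (∀ k, v (k + 1) ≤ v k) ∧ Filter.Tendsto v Filter.atTop (nhds 0)}

/-- `F₊(v)(k) = α (v(k-1)^L - v(k)^L)` for `k ≥ 1`, and `F₊(v)(0) = 0`. -/
def FPlus (α : ℝ) (L : ℕ) (v : ℕ → ℝ) : ℕ → ℝ
  | 0 => 0
  | k + 1 => α * (v k ^ L - v (k + 1) ^ L)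

/-- `F₋(v)(k) = β (v(k) - v(k+1))` for `k ≥ 1`, and `F₋(v)(0) = 0`. -/
def FMinus (β : ℝ) (v : ℕ → ℝ) : ℕ → ℝ
  | 0 => 0
  | k + 1 => β * (v (k + 1) - v (k + 2))

/-- `u` takes values in `𝒱` on `[0, ∞)` and solves `u̇ₜ(k) = F₊(uₜ)(k) - F₋(uₜ)(k)`
for all `t ≥ 0` and `k ≥ 1` (with the one-sided derivative at `t = 0`).
Values of `u` at negative times are irrelevant. -/
structure IsMeanFieldSolution (α β : ℝ) (L : ℕ) (u : ℝ → ℕ → ℝ) : Prop where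
  mem : ∀ t, 0 ≤ t → u t ∈ TailSeq
  deriv : ∀ t, 0 ≤ t → ∀ k, 1 ≤ k →
    HasDerivWithinAt (fun s => u s k) (FPlus α L (u t) k - FMinus β (u t) k) (Set.Ici 0) t

/-- A sequence of positive weights `(w(k))_{k ≥ 1}`. The value at `0` is never used. -/
structure PosWeight where
  toFun : ℕ → ℝ
  pos : ∀ k, 1 ≤ k → 0 < toFun k

instance : CoeFun PosWeight (fun _ => ℕ → ℝ) := ⟨PosWeight.toFun⟩

/-- There are `c, d > 0` with `c w(k+1) ≤ w(k) ≤ d w(k+1)` for all `k ≥ 1`. -/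
def PosWeight.Comparable (w : PosWeight) : Prop :=
  ∃ c d : ℝ, 0 < c ∧ 0 < d ∧ ∀ k, 1 ≤ k → c * w (k + 1) ≤ w k ∧ w k ≤ d * w (k + 1)

/-- `∑_{k ≥ 1} |x(k)| / w(k) < ∞`. -/
def PosWeight.EllOneSummable (w : PosWeight) (x : ℕ → ℝ) : Prop :=
  Summable fun k => |x (k + 1)| / w (k + 1)

namespace PosWeight

lemma pos_succ (w : PosWeight) (k : ℕ) : 0 < w (k + 1) := w.pos _ (Nat.succ_pos k)

/-- `L₂(w)` as a linear subspace of the space of all sequences: `x(0) = 0` and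
`∑_{k ≥ 1} x(k)² / w(k) < ∞`. -/
def L2Submodule (w : PosWeight) : Submodule ℝ (ℕ → ℝ) where
  carrier := {x | x 0 = 0 ∧ Summable fun k => x (k + 1) ^ 2 / w (k + 1)}
  zero_mem' := by simp
  add_mem' := by
    rintro x y ⟨hx, hx'⟩ ⟨hy, hy'⟩
    refine ⟨by simp [hx, hy], ?_⟩
    refine Summable.of_nonneg_of_le (fun k => ?_) (fun k => ?_)
      ((hx'.mul_left 2).add (hy'.mul_left 2))
    · exact div_nonneg (sq_nonneg _) (w.pos_succ k).le
    · have h : (x (k + 1) + y (k + 1)) ^ 2 ≤ 2 * x (k + 1) ^ 2 + 2 * y (k + 1) ^ 2 := by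
        nlinarith [sq_nonneg (x (k + 1) - y (k + 1))]
      calc (x + y) (k + 1) ^ 2 / w (k + 1)
          ≤ (2 * x (k + 1) ^ 2 + 2 * y (k + 1) ^ 2) / w (k + 1) :=
            div_le_div_of_nonneg_right h (w.pos_succ k).le
        _ = _ := by ring
  smul_mem' := by
    rintro a x ⟨hx, hx'⟩
    refine ⟨by simp [hx], (hx'.mul_left (a ^ 2)).congr fun k => ?_⟩
    simp only [Pi.smul_apply, smul_eq_mul]
    ring

/-- The Hilbert space `L₂(w)`. It is a type of its own, so that its topology is the
one of its norm and not the product topology of the space of sequences. -/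
def L2 (w : PosWeight) : Type := w.L2Submodule

variable {w : PosWeight}

instance : AddCommGroup w.L2 := inferInstanceAs (AddCommGroup w.L2Submodule)

instance : Module ℝ w.L2 := inferInstanceAs (Module ℝ w.L2Submodule)

instance : CoeFun w.L2 (fun _ => ℕ → ℝ) := ⟨fun x => Subtype.val x⟩

namespace L2

lemma add_apply (x y : w.L2) (k : ℕ) : (x + y) k = x k + y k := rfl

lemma smul_apply (a : ℝ) (x : w.L2) (k : ℕ) : (a • x) k = a * x k := rfl

lemma apply_zero (x : w.L2) : x 0 = 0 := (Subtype.property x).1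

lemma summable_sq (x : w.L2) : Summable fun k => x (k + 1) ^ 2 / w (k + 1) :=
  (Subtype.property x).2

lemma summable_mul (x y : w.L2) : Summable fun k => x (k + 1) * y (k + 1) / w (k + 1) := by
  refine Summable.of_norm_bounded (x.summable_sq.add y.summable_sq) fun k => ?_
  rw [Real.norm_eq_abs, abs_div, abs_of_pos (w.pos_succ k), ← add_div]
  refine div_le_div_of_nonneg_right ?_ (w.pos_succ k).le
  rw [abs_le]
  constructor <;> nlinarith [sq_nonneg (x (k + 1) - y (k + 1)), sq_nonneg (x (k + 1) + y (k + 1)),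
    sq_nonneg (x (k + 1)), sq_nonneg (y (k + 1))]

/-- The inner product `⟨x, y⟩ = ∑_{k ≥ 1} x(k) y(k) / w(k)` of `L₂(w)`. -/
abbrev core (w : PosWeight) : InnerProductSpace.Core ℝ w.L2 where
  inner x y := ∑' k, x (k + 1) * y (k + 1) / w (k + 1)
  conj_inner_symm x y := by simp [mul_comm]
  re_inner_nonneg x := by
    simp only [RCLike.re_to_real]
    exact tsum_nonneg fun k => div_nonneg (mul_self_nonneg _) (w.pos_succ k).le
  add_left x y z := by
    rw [← (summable_mul x z).tsum_add (summable_mul y z)]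
    exact tsum_congr fun k => by rw [add_apply]; ring
  smul_left x y a := by
    simp only [conj_trivial]
    rw [← tsum_mul_left]
    exact tsum_congr fun k => by rw [smul_apply]; ring
  definite x hx := by
    have h0 : ∀ k, 0 ≤ x (k + 1) * x (k + 1) / w (k + 1) := fun k =>
      div_nonneg (mul_self_nonneg _) (w.pos_succ k).le
    have h1 := ((summable_mul x x).hasSum_iff.2 hx)
    have h2 := (hasSum_zero_iff_of_nonneg h0).1 h1
    refine Subtype.ext (funext fun k => ?_)
    cases k with
    | zero => exact x.apply_zero
    | succ k =>
      have h3 := congrFun h2 k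
      simp only [Pi.zero_apply, div_eq_zero_iff, (w.pos_succ k).ne', or_false] at h3
      exact mul_self_eq_zero.1 h3

instance : NormedAddCommGroup w.L2 := (core w).toNormedAddCommGroup

instance : InnerProductSpace ℝ w.L2 := InnerProductSpace.ofCore (core w).toCore

/-- `‖x‖² = ∑_{k ≥ 1} x(k)² / w(k)`. -/
lemma norm_sq_eq (x : w.L2) : ‖x‖ ^ 2 = ∑' k, x (k + 1) ^ 2 / w (k + 1) := by
  rw [← real_inner_self_eq_norm_sq]
  exact tsum_congr fun k => by rw [pow_two]

/-- The isometry `x ↦ (x(k+1) / √w(k+1))_{k ≥ 0}` onto the unweighted space `ℓ²`. -/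
def toEllTwo (w : PosWeight) : w.L2 →ₗᵢ[ℝ] lp (fun _ : ℕ => ℝ) 2 where
  toFun x := ⟨fun k => x (k + 1) / √(w (k + 1)), by
    refine memℓp_gen (x.summable_sq.congr fun k => ?_)
    simp [div_pow, Real.sq_sqrt (w.pos_succ k).le]⟩
  map_add' x y := by
    ext k
    exact add_div _ _ _
  map_smul' a x := by
    ext k
    exact mul_div_assoc _ _ _
  norm_map' x := by
    rw [← sq_eq_sq₀ (norm_nonneg _) (norm_nonneg _), norm_sq_eq,
      ← real_inner_self_eq_norm_sq, lp.inner_eq_tsum]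
    refine tsum_congr fun k => ?_
    simp [div_pow, Real.sq_sqrt (w.pos_succ k).le]

lemma toEllTwo_surjective : Function.Surjective (toEllTwo w) := by
  intro y
  have hy := (lp.memℓp y).summable (by simp)
  refine ⟨⟨fun k => Nat.casesOn k 0 fun k => y k * √(w (k + 1)), rfl, ?_⟩, ?_⟩
  · refine hy.congr fun k => ?_
    simp [mul_pow, Real.sq_sqrt (w.pos_succ k).le, (w.pos_succ k).ne']
  · ext k
    exact mul_div_cancel_right₀ _ (Real.sqrt_pos.2 (w.pos_succ k)).ne'

instance : CompleteSpace w.L2 :=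
  ((toEllTwo w).isometry.isUniformInducing.completeSpace_congr toEllTwo_surjective).2 inferInstance

end L2

end PosWeight

/-- `M = (M(k))_{k ≥ 0}` is a family of independent real continuous centered Gaussian
martingales, null at time `0`, with the deterministic Doob–Meyer brackets
`⟨M(k)⟩ₜ = ∫₀ᵗ (F₊(uₛ)(k) + F₋(uₛ)(k)) ds`, that is, `M(k)² - ⟨M(k)⟩` is a martingale.
The martingale properties of `M(k)` refer to the filtration generated by `M(k)`. -/
structure IsLimitMartingale {Ω : Type*} [MeasurableSpace Ω] (P : Measure Ω)
    (α β : ℝ) (L : ℕ) (u : ℝ → ℕ → ℝ) (M : ℕ → ℝ≥0 → Ω → ℝ) : Prop where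
  stronglyMeasurable : ∀ k t, StronglyMeasurable (M k t)
  indep : iIndepFun (fun k ω t => M k t ω) P
  continuous : ∀ k, ∀ᵐ ω ∂P, Continuous fun t => M k t ω
  gaussian : ∀ k, IsGaussianProcess (M k) P
  centered : ∀ k t, ∫ ω, M k t ω ∂P = 0
  null_at_zero : ∀ k, ∀ᵐ ω ∂P, M k 0 ω = 0
  martingale : ∀ k, Martingale (M k) (Filtration.natural (M k) (stronglyMeasurable k)) P
  bracket : ∀ k, Martingale
    (fun t ω => M k t ω ^ 2 - ∫ s in (0 : ℝ)..t, (FPlus α L (u s) k + FMinus β (u s) k))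
    (Filtration.natural (M k) (stronglyMeasurable k)) P

/-- The filtration generated by the whole family `M = (M(k))_{k ≥ 0}`. -/
def jointFiltration {Ω : Type*} [mΩ : MeasurableSpace Ω] (M : ℕ → ℝ≥0 → Ω → ℝ)
    (hM : ∀ k t, StronglyMeasurable (M k t)) : Filtration ℝ≥0 mΩ :=
  Filtration.natural (fun t ω k => M k t ω)
    (fun t => (measurable_pi_lambda _ fun k => (hM k t).measurable).stronglyMeasurable)

end

/-! The bracket gives `E M_t(k)^2 = ⟨M(k)⟩_t`, so everything rests on the finiteness of `∑ ⟨M(k)⟩_t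
/ w(k)`. Since `F₊(v)(k) ≤ α v(k-1)` and `F₋(v)(k) ≤ β v(k)`, this follows from a bound on the
weighted `ℓ¹` norm of `u_s` over `[0, t]`, obtained by Gronwall (`exists_sum_le`,
`exists_sum_bracket_le`); comparability of the weights absorbs the index shift.

That sum gives membership only for each fixed `t`. For all `t` at once, the partial sums of
`M_t(k)^2 / w(k)` are continuous submartingales, increasing in the number of terms and bounded in
`L¹`, so a maximal inequality bounds them uniformly on compact intervals
(`ae_exists_forall_le_of_submartingale`).

By independence, each coordinate remains a martingale in the joint filtration
(`martingale_jointFiltration`). Coordinates are continuous functionals, so the martingale property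
passes to the vector (`martingale_of_coord`). -/

/-! ### Independent enlargement of filtrations. -/

lemma isPiSystem_inter_measurableSet {Ω : Type*} (m G : MeasurableSpace Ω) :
    IsPiSystem {s : Set Ω | ∃ A B, MeasurableSet[m] A ∧ MeasurableSet[G] B ∧ s = A ∩ B} := by
  rintro _ ⟨A, B, hA, hB, rfl⟩ _ ⟨C, D, hC, hD, rfl⟩ -
  exact ⟨A ∩ C, B ∩ D, hA.inter hC, hB.inter hD, Set.inter_inter_inter_comm A B C D⟩

lemma sup_eq_generateFrom_inter {Ω : Type*} (m G : MeasurableSpace Ω) :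
    m ⊔ G = MeasurableSpace.generateFrom
      {s : Set Ω | ∃ A B, MeasurableSet[m] A ∧ MeasurableSet[G] B ∧ s = A ∩ B} := by
  apply le_antisymm
  · refine sup_le (fun A hA => ?_) (fun B hB => ?_)
    · exact MeasurableSpace.measurableSet_generateFrom ⟨A, Set.univ, hA, .univ, by simp⟩
    · exact MeasurableSpace.measurableSet_generateFrom ⟨Set.univ, B, .univ, hB, by simp⟩
  · refine MeasurableSpace.generateFrom_le ?_
    rintro _ ⟨A, B, hA, hB, rfl⟩
    exact MeasurableSet.inter (le_sup_left (a := m) (b := G) _ hA)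
      (le_sup_right (a := m) (b := G) _ hB)

/-- Given `G`, the variable `A.indicator f` has constant conditional expectation. -/
lemma setIntegral_inter_of_indep {Ω : Type*} {mΩ : MeasurableSpace Ω} {P : Measure Ω}
    [IsProbabilityMeasure P] {n G : MeasurableSpace Ω} (hn : n ≤ mΩ) (hG : G ≤ mΩ)
    (hind : Indep n G P) {f : Ω → ℝ} (hf : StronglyMeasurable[n] f) (hfi : Integrable f P)
    {A B : Set Ω} (hA : MeasurableSet[n] A) (hB : MeasurableSet[G] B) :
    ∫ ω in A ∩ B, f ω ∂P = P.real B * ∫ ω in A, f ω ∂P := by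
  have hAf : StronglyMeasurable[n] (A.indicator f) := hf.indicator hA
  have hAi : Integrable (A.indicator f) P := hfi.indicator (hn _ hA)
  rw [Set.inter_comm, ← setIntegral_indicator (hn _ hA), ← setIntegral_condExp hG hAi hB,
    setIntegral_congr_ae (hG _ hB) ((condExp_indep_eq hn hG hAf hind).mono fun _ h _ => h),
    setIntegral_const, integral_indicator (hn _ hA), smul_eq_mul]

/-- Enlarging the conditioning by an independent `σ`-algebra does not change the conditional
expectation. -/
lemma condExp_sup_of_indep {Ω : Type*} {mΩ : MeasurableSpace Ω} {P : Measure Ω}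
    [IsProbabilityMeasure P] {m n G : MeasurableSpace Ω} (hmn : m ≤ n) (hn : n ≤ mΩ)
    (hG : G ≤ mΩ) (hind : Indep n G P) {f : Ω → ℝ} (hf : StronglyMeasurable[n] f)
    (hfi : Integrable f P) : P[f | m ⊔ G] =ᵐ[P] P[f | m] := by
  have hm : m ≤ mΩ := hmn.trans hn
  have hmG : m ⊔ G ≤ mΩ := sup_le hm hG
  -- π-λ argument on the sets `A ∩ B`: `f` and `P[f | m]` are both `n`-measurable, so the same
  -- factor `P(B)` comes out of both integrals.
  have key : ∀ s, MeasurableSet[m ⊔ G] s → ∫ ω in s, (P[f | m]) ω ∂P = ∫ ω in s, f ω ∂P := by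
    intro s hs
    refine MeasurableSpace.induction_on_inter
      (C := fun s _ => ∫ ω in s, (P[f | m]) ω ∂P = ∫ ω in s, f ω ∂P)
      (sup_eq_generateFrom_inter m G) (isPiSystem_inter_measurableSet m G) ?_ ?_ ?_ ?_ s hs
    · simp
    · rintro _ ⟨A, B, hA, hB, rfl⟩
      rw [setIntegral_inter_of_indep hn hG hind (stronglyMeasurable_condExp.mono hmn)
        integrable_condExp (hmn _ hA) hB,
        setIntegral_inter_of_indep hn hG hind hf hfi (hmn _ hA) hB,
        setIntegral_condExp hm hfi hA]
    · intro t ht h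
      rw [setIntegral_compl (hmG _ ht) integrable_condExp, setIntegral_compl (hmG _ ht) hfi, h,
        integral_condExp hm]
    · intro t hd ht h
      rw [integral_iUnion (fun i => hmG _ (ht i)) hd integrable_condExp.integrableOn,
        integral_iUnion (fun i => hmG _ (ht i)) hd hfi.integrableOn]
      exact tsum_congr h
  exact (ae_eq_condExp_of_forall_setIntegral_eq hmG hfi
    (fun _ _ _ => integrable_condExp.integrableOn) (fun s hs _ => key s hs)
    (stronglyMeasurable_condExp.mono (le_sup_left : m ≤ m ⊔ G)).aestronglyMeasurable).symm

lemma comap_le_jointFiltration {Ω : Type*} [MeasurableSpace Ω] {M : ℕ → ℝ≥0 → Ω → ℝ}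
    (hM : ∀ k t, StronglyMeasurable (M k t)) (k : ℕ) {r t : ℝ≥0} (hrt : r ≤ t) :
    MeasurableSpace.comap (M k r) inferInstance ≤ jointFiltration M hM t := by
  refine le_trans ?_ (le_iSup₂ (f := fun (j : ℝ≥0) (_ : j ≤ t) =>
    MeasurableSpace.comap (fun ω k => M k j ω) MeasurableSpace.pi) r hrt)
  rintro _ ⟨A, hA, rfl⟩
  exact ⟨(fun x => x k) ⁻¹' A, measurable_pi_apply k hA, rfl⟩

lemma stronglyMeasurable_jointFiltration {Ω : Type*} [MeasurableSpace Ω] {M : ℕ → ℝ≥0 → Ω → ℝ}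
    (hM : ∀ k t, StronglyMeasurable (M k t)) (k : ℕ) (t : ℝ≥0) :
    StronglyMeasurable[jointFiltration M hM t] (M k t) :=
  (Measurable.of_comap_le (comap_le_jointFiltration hM k le_rfl)).stronglyMeasurable

lemma natural_le_jointFiltration {Ω : Type*} [MeasurableSpace Ω] {M : ℕ → ℝ≥0 → Ω → ℝ}
    (hM : ∀ k t, StronglyMeasurable (M k t)) (k : ℕ) (t : ℝ≥0) :
    Filtration.natural (M k) (hM k) t ≤ jointFiltration M hM t := by
  refine iSup₂_le fun r hr => ?_
  exact comap_le_jointFiltration hM k hr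

/-- A martingale in the filtration generated by one of several independent processes is a
martingale in the filtration generated by all of them. -/
lemma martingale_jointFiltration {Ω : Type*} [mΩ : MeasurableSpace Ω] {P : Measure Ω}
    [IsProbabilityMeasure P] {M : ℕ → ℝ≥0 → Ω → ℝ}
    (hM : ∀ k t, StronglyMeasurable (M k t)) (hind : iIndepFun (fun k ω t => M k t ω) P)
    {k : ℕ} {f : ℝ≥0 → Ω → ℝ} (hf : Martingale f (Filtration.natural (M k) (hM k)) P) :
    Martingale f (jointFiltration M hM) P := by
  refine ⟨fun t => (hf.stronglyAdapted t).mono (natural_le_jointFiltration hM k t),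
    fun s t hst => ?_⟩
  let m : ℕ → MeasurableSpace Ω := fun j =>
    MeasurableSpace.comap (fun ω t => M j t ω) MeasurableSpace.pi
  have hcomap : ∀ j r, MeasurableSpace.comap (M j r) inferInstance ≤ m j := by
    rintro j r _ ⟨A, hA, rfl⟩
    exact ⟨(fun x => x r) ⁻¹' A, measurable_pi_apply r hA, rfl⟩
  have hm : ∀ j, m j ≤ mΩ := fun j =>
    (measurable_pi_lambda _ fun r => (hM j r).measurable).comap_le
  have hG : (⨆ j ∈ ({k}ᶜ : Set ℕ), m j) ≤ mΩ := iSup₂_le fun j _ => hm j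
  have hI : Indep (m k) (⨆ j ∈ ({k}ᶜ : Set ℕ), m j) P := by
    have := indep_iSup_of_disjoint hm hind.iIndep
      (S := {k}) (T := {k}ᶜ) disjoint_compl_right
    simpa only [Set.mem_singleton_iff, iSup_iSup_eq_left] using this
  have hnat : ∀ r, Filtration.natural (M k) (hM k) r ≤ m k := fun r => by
    refine iSup₂_le fun q _ => ?_
    exact hcomap k q
  -- The other processes may be revealed over all times, not just up to `s`; the tower property then
  -- returns to the joint filtration.
  have hle : jointFiltration M hM s ≤
      Filtration.natural (M k) (hM k) s ⊔ (⨆ j ∈ ({k}ᶜ : Set ℕ), m j) := by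
    refine iSup₂_le fun r hr => ?_
    refine Measurable.comap_le (@measurable_pi_lambda _ _ _ (_) _ _ fun j => ?_)
    refine Measurable.of_comap_le ?_
    by_cases hj : j = k
    · subst hj
      refine le_trans ?_ le_sup_left
      exact le_iSup₂ (f := fun (q : ℝ≥0) (_ : q ≤ s) =>
        MeasurableSpace.comap (M j q) Real.measurableSpace) r hr
    · refine le_trans (hcomap j r) (le_trans ?_ le_sup_right)
      exact le_iSup₂ (f := fun (j : ℕ) (_ : j ∈ ({k}ᶜ : Set ℕ)) => m j) j hj
  have h1 : P[f t | Filtration.natural (M k) (hM k) s ⊔ (⨆ j ∈ ({k}ᶜ : Set ℕ), m j)] =ᵐ[P] f s :=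
    (condExp_sup_of_indep (hnat s) (hm k) hG hI ((hf.stronglyAdapted t).mono (hnat t))
      (hf.integrable t)).trans (hf.condExp_ae_eq hst)
  refine (condExp_condExp_of_le hle (sup_le ((hnat s).trans (hm k)) hG)).symm.trans ?_
  refine (condExp_congr_ae h1).trans ?_
  rw [condExp_of_stronglyMeasurable ((jointFiltration M hM).le s)
    ((hf.stronglyAdapted s).mono (natural_le_jointFiltration hM k s)) (hf.integrable s)]

/-! ### Deterministic estimates on the rates and the solution. -/

namespace TailSeq

variable {v : ℕ → ℝ}

lemma nonneg (hv : v ∈ TailSeq) (k : ℕ) : 0 ≤ v k :=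
  (antitone_nat_of_succ_le hv.2.1).le_of_tendsto hv.2.2 k

lemma le_one (hv : v ∈ TailSeq) (k : ℕ) : v k ≤ 1 :=
  hv.1 ▸ antitone_nat_of_succ_le hv.2.1 (Nat.zero_le k)

end TailSeq

lemma FPlus_nonneg {α : ℝ} (hα : 0 < α) (L : ℕ) {v : ℕ → ℝ} (hv : v ∈ TailSeq) (k : ℕ) :
    0 ≤ FPlus α L v k := by
  cases k with
  | zero => exact le_rfl
  | succ k =>
    exact mul_nonneg hα.le
      (sub_nonneg.2 (pow_le_pow_left₀ (TailSeq.nonneg hv _) (hv.2.1 k) L))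

lemma FPlus_succ_le {α : ℝ} (hα : 0 < α) {L : ℕ} (hL : 1 ≤ L) {v : ℕ → ℝ} (hv : v ∈ TailSeq)
    (k : ℕ) : FPlus α L v (k + 1) ≤ α * v k := by
  refine mul_le_mul_of_nonneg_left ?_ hα.le
  have h1 := pow_le_of_le_one (TailSeq.nonneg hv k) (TailSeq.le_one hv k) (by omega : L ≠ 0)
  have h2 := pow_nonneg (TailSeq.nonneg hv (k + 1)) L
  linarith

lemma FMinus_nonneg {β : ℝ} (hβ : 0 < β) {v : ℕ → ℝ} (hv : v ∈ TailSeq) (k : ℕ) :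
    0 ≤ FMinus β v k := by
  cases k with
  | zero => exact le_rfl
  | succ k => exact mul_nonneg hβ.le (sub_nonneg.2 (hv.2.1 _))

lemma FMinus_succ_le {β : ℝ} (hβ : 0 < β) {v : ℕ → ℝ} (hv : v ∈ TailSeq) (k : ℕ) :
    FMinus β v (k + 1) ≤ β * v (k + 1) :=
  mul_le_mul_of_nonneg_left (by linarith [TailSeq.nonneg hv (k + 2)]) hβ.le

namespace IsMeanFieldSolution

variable {α β : ℝ} {L : ℕ} {u : ℝ → ℕ → ℝ}

lemma continuousOn (hu : IsMeanFieldSolution α β L u) (k : ℕ) :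
    ContinuousOn (fun s => u s k) (Set.Ici 0) := by
  cases k with
  | zero => exact (continuousOn_const (c := (1 : ℝ))).congr fun s hs => (hu.mem s hs).1
  | succ k => exact fun s hs => (hu.deriv s hs (k + 1) (Nat.succ_pos k)).continuousWithinAt

lemma continuousOn_rate (hu : IsMeanFieldSolution α β L u) (k : ℕ) :
    ContinuousOn (fun s => FPlus α L (u s) k + FMinus β (u s) k) (Set.Ici 0) := by
  cases k with
  | zero => simpa [FPlus, FMinus] using! continuousOn_const
  | succ k =>
    simp only [FPlus, FMinus]
    exact (continuousOn_const.mul (((hu.continuousOn k).pow L).sub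
      ((hu.continuousOn (k + 1)).pow L))).add
      (continuousOn_const.mul ((hu.continuousOn (k + 1)).sub (hu.continuousOn (k + 2))))

lemma intervalIntegrable_rate (hu : IsMeanFieldSolution α β L u) (k : ℕ) {s t : ℝ} (hs : 0 ≤ s)
    (ht : 0 ≤ t) :
    IntervalIntegrable (fun s => FPlus α L (u s) k + FMinus β (u s) k) volume s t :=
  ((hu.continuousOn_rate k).mono fun _ hx => (le_min hs ht).trans hx.1).intervalIntegrable

lemma rate_nonneg (hu : IsMeanFieldSolution α β L u) (hα : 0 < α) (hβ : 0 < β) (k : ℕ) {s : ℝ}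
    (hs : 0 ≤ s) : 0 ≤ FPlus α L (u s) k + FMinus β (u s) k :=
  add_nonneg (FPlus_nonneg hα L (hu.mem s hs) k) (FMinus_nonneg hβ (hu.mem s hs) k)

lemma bracket_mono (hu : IsMeanFieldSolution α β L u) (hα : 0 < α) (hβ : 0 < β) (k : ℕ) {s t : ℝ}
    (hs : 0 ≤ s) (hst : s ≤ t) :
    ∫ r in (0 : ℝ)..s, (FPlus α L (u r) k + FMinus β (u r) k) ≤
      ∫ r in (0 : ℝ)..t, (FPlus α L (u r) k + FMinus β (u r) k) := by
  rw [← intervalIntegral.integral_add_adjacent_intervals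
    (hu.intervalIntegrable_rate k le_rfl hs) (hu.intervalIntegrable_rate k hs (hs.trans hst))]
  exact le_add_of_nonneg_right (intervalIntegral.integral_nonneg hst fun r hr =>
    hu.rate_nonneg hα hβ k (hs.trans hr.1))

end IsMeanFieldSolution

/-- `F₊` looks one index back; comparability moves the weight back with it. The unmatched term `k =
0` is `v 0 / w 1 = 1 / w 1`. -/
lemma PosWeight.sum_shift_le (w : PosWeight) {d : ℝ} (hd : ∀ k, 1 ≤ k → w k ≤ d * w (k + 1))
    (hd0 : 0 < d) {v : ℕ → ℝ} (hv : v ∈ TailSeq) (n : ℕ) :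
    ∑ k ∈ Finset.range n, v k / w (k + 1) ≤
      1 / w 1 + d * ∑ k ∈ Finset.range n, v (k + 1) / w (k + 1) := by
  cases n with
  | zero => simpa using (w.pos_succ 0).le
  | succ n =>
    rw [Finset.sum_range_succ', hv.1, zero_add, add_comm, Finset.sum_range_succ, mul_add,
      Finset.mul_sum]
    have h1 : ∑ k ∈ Finset.range n, v (k + 1) / w (k + 1 + 1) ≤
        ∑ k ∈ Finset.range n, d * (v (k + 1) / w (k + 1)) := by
      refine Finset.sum_le_sum fun k _ => ?_
      rw [← mul_div_assoc, div_le_div_iff₀ (w.pos_succ _) (w.pos_succ _)]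
      nlinarith [mul_le_mul_of_nonneg_left (hd (k + 1) (Nat.succ_pos k))
        (TailSeq.nonneg hv (k + 1))]
    have h2 : 0 ≤ d * (v (n + 1) / w (n + 1)) :=
      mul_nonneg hd0.le (div_nonneg (TailSeq.nonneg hv _) (w.pos_succ n).le)
    linarith

namespace IsMeanFieldSolution

variable {α β : ℝ} {L : ℕ} {u : ℝ → ℕ → ℝ} {w : PosWeight}

/-- The weighted `ℓ¹` norm of the solution is bounded on bounded time intervals. -/
lemma exists_sum_le (hu : IsMeanFieldSolution α β L u) (hα : 0 < α) (hβ : 0 < β) (hL : 1 ≤ L)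
    (hw : w.Comparable) (hu0 : w.EllOneSummable (u 0)) (T : ℝ) :
    ∃ C, ∀ s ∈ Set.Icc 0 T, ∀ n, ∑ k ∈ Finset.range n, u s (k + 1) / w (k + 1) ≤ C := by
  obtain ⟨_, d, _, hd0, hcd⟩ := hw
  have hw1 : 0 < w 1 := w.pos_succ 0
  have hδ : 0 ≤ ∑' k, |u 0 (k + 1)| / w (k + 1) :=
    tsum_nonneg fun k => div_nonneg (abs_nonneg _) (w.pos_succ k).le
  -- Gronwall is applied to finite partial sums, with a bound free of `n`; this avoids
  -- differentiating a series. Dropping `-F₋` leaves slope `α d` and source `α / w 1`, both from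
  -- `sum_shift_le`.
  refine ⟨gronwallBound (∑' k, |u 0 (k + 1)| / w (k + 1)) (α * d) (α * (1 / w 1)) T,
    fun s hs n => ?_⟩
  have key := le_gronwallBound_of_liminf_deriv_right_le
    (f := fun s => ∑ k ∈ Finset.range n, u s (k + 1) / w (k + 1))
    (f' := fun s => ∑ k ∈ Finset.range n,
      (FPlus α L (u s) (k + 1) - FMinus β (u s) (k + 1)) / w (k + 1))
    (δ := ∑' k, |u 0 (k + 1)| / w (k + 1)) (K := α * d) (ε := α * (1 / w 1)) (a := 0) (b := T)
    ?_ ?_ ?_ ?_ s hs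
  · refine key.trans ?_
    rw [sub_zero]
    exact gronwallBound_mono hδ (by positivity) (by positivity) hs.2
  · refine (continuousOn_finsetSum _ fun k _ => ?_).mono Set.Icc_subset_Ici_self
    exact (hu.continuousOn (k + 1)).div_const _
  · intro x hx r hr
    have hder : HasDerivWithinAt (fun s => ∑ k ∈ Finset.range n, u s (k + 1) / w (k + 1))
        (∑ k ∈ Finset.range n,
          (FPlus α L (u x) (k + 1) - FMinus β (u x) (k + 1)) / w (k + 1)) (Set.Ici x) x :=
      HasDerivWithinAt.fun_sum fun k _ =>
        ((hu.deriv x hx.1 (k + 1) (Nat.succ_pos k)).mono (Set.Ici_subset_Ici.2 hx.1)).div_const _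
    exact (hder.liminf_right_slope_le hr).mono fun z hz => by
      simpa [slope_def_field, div_eq_inv_mul] using hz
  · refine (Finset.sum_le_sum fun k _ => ?_).trans
      (Summable.sum_le_tsum (Finset.range n)
        (fun k _ => div_nonneg (abs_nonneg _) (w.pos_succ k).le) hu0)
    exact div_le_div_of_nonneg_right (le_abs_self _) (w.pos_succ k).le
  · intro x hx
    have hv := hu.mem x hx.1
    have h1 : ∑ k ∈ Finset.range n,
        (FPlus α L (u x) (k + 1) - FMinus β (u x) (k + 1)) / w (k + 1) ≤
        α * ∑ k ∈ Finset.range n, u x k / w (k + 1) := by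
      rw [Finset.mul_sum]
      refine Finset.sum_le_sum fun k _ => ?_
      rw [← mul_div_assoc]
      refine div_le_div_of_nonneg_right ?_ (w.pos_succ k).le
      linarith [FPlus_succ_le hα hL hv k, FMinus_nonneg hβ hv (k + 1)]
    refine h1.trans ((mul_le_mul_of_nonneg_left
      (w.sum_shift_le (fun k hk => (hcd k hk).2) hd0 hv n) hα.le).trans_eq ?_)
    ring

lemma exists_sum_bracket_le (hu : IsMeanFieldSolution α β L u) (hα : 0 < α) (hβ : 0 < β)
    (hL : 1 ≤ L) (hw : w.Comparable) (hu0 : w.EllOneSummable (u 0)) {T : ℝ} (hT : 0 ≤ T) :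
    ∃ C, ∀ n, ∑ k ∈ Finset.range n,
      (∫ s in (0 : ℝ)..T, (FPlus α L (u s) (k + 1) + FMinus β (u s) (k + 1))) / w (k + 1) ≤ C := by
  obtain ⟨C, hC⟩ := hu.exists_sum_le hα hβ hL hw hu0 T
  obtain ⟨_, d, _, hd0, hcd⟩ := hw
  refine ⟨∫ _ in (0 : ℝ)..T, (α * (1 / w 1 + d * C) + β * C), fun n => ?_⟩
  simp_rw [← intervalIntegral.integral_div]
  rw [← intervalIntegral.integral_finsetSum fun k _ =>
    (hu.intervalIntegrable_rate (k + 1) le_rfl hT).div_const _]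
  refine intervalIntegral.integral_mono_on hT (ContinuousOn.intervalIntegrable
    (continuousOn_finsetSum _ fun k _ => ((hu.continuousOn_rate (k + 1)).mono
      fun _ hx => (le_min le_rfl hT).trans hx.1).div_const _))
    intervalIntegrable_const fun s hs => ?_
  have hv := hu.mem s hs.1
  have h1 : ∑ k ∈ Finset.range n, (FPlus α L (u s) (k + 1) + FMinus β (u s) (k + 1)) / w (k + 1) ≤
      α * ∑ k ∈ Finset.range n, u s k / w (k + 1) +
        β * ∑ k ∈ Finset.range n, u s (k + 1) / w (k + 1) := by
    rw [Finset.mul_sum, Finset.mul_sum, ← Finset.sum_add_distrib]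
    refine Finset.sum_le_sum fun k _ => ?_
    rw [← mul_div_assoc, ← mul_div_assoc, ← add_div]
    exact div_le_div_of_nonneg_right (add_le_add (FPlus_succ_le hα hL hv k)
      (FMinus_succ_le hβ hv k)) (w.pos_succ k).le
  refine h1.trans (add_le_add (mul_le_mul_of_nonneg_left ?_ hα.le)
    (mul_le_mul_of_nonneg_left (hC s hs n) hβ.le))
  refine (w.sum_shift_le (fun k hk => (hcd k hk).2) hd0 hv n).trans ?_
  gcongr
  exact hC s hs n

end IsMeanFieldSolution

/-! ### Maximal inequality for increasing sequences of submartingales. -/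

/-- Sampling a submartingale along a monotone sequence of times. -/
lemma submartingale_comp_monotone {Ω ι κ : Type*} [Preorder ι] [Preorder κ]
    {mΩ : MeasurableSpace Ω} {P : Measure Ω} {ℱ : Filtration ι mΩ} {f : ι → Ω → ℝ}
    (hf : Submartingale f ℱ P) {τ : κ → ι} (hτ : Monotone τ) :
    Submartingale (fun i => f (τ i))
      ⟨fun i => ℱ (τ i), fun _ _ hij => ℱ.mono (hτ hij), fun i => ℱ.le (τ i)⟩ P :=
  ⟨fun i => hf.stronglyAdapted (τ i), fun _ _ hij => hf.ae_le_condExp (hτ hij),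
    fun i => hf.integrable (τ i)⟩

lemma mul_measure_exists_le {Ω : Type*} {mΩ : MeasurableSpace Ω} {P : Measure Ω}
    [IsFiniteMeasure P] {ℱ : Filtration ℝ≥0 mΩ} {f : ℝ≥0 → Ω → ℝ} (hf : Submartingale f ℱ P)
    (h0 : ∀ t ω, 0 ≤ f t ω) {τ : ℕ → ℝ≥0} (hτ : Monotone τ) (ε : ℝ≥0) (n : ℕ) :
    ε * P {ω | ∃ i ≤ n, (ε : ℝ) ≤ f (τ i) ω} ≤ ENNReal.ofReal (∫ ω, f (τ n) ω ∂P) := by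
  have h := maximal_ineq (submartingale_comp_monotone hf hτ) (fun i ω => h0 (τ i) ω) (ε := ε) n
  have hset : {ω | (ε : ℝ) ≤ (Finset.range (n + 1)).sup' Finset.nonempty_range_add_one
      fun k => f (τ k) ω} = {ω | ∃ i ≤ n, (ε : ℝ) ≤ f (τ i) ω} := by
    ext ω
    simp [Finset.le_sup'_iff]
  rw [hset] at h
  exact h.trans (ENNReal.ofReal_le_ofReal
    (setIntegral_le_integral (hf.integrable _) (ae_of_all _ fun ω => h0 _ ω)))

/-- An increasing sequence of continuous nonnegative submartingales bounded in `L¹` is almost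
surely bounded, uniformly on compact time intervals. -/
lemma ae_exists_forall_le_of_submartingale {Ω : Type*} {mΩ : MeasurableSpace Ω} {P : Measure Ω}
    [IsFiniteMeasure P] {ℱ : Filtration ℝ≥0 mΩ} {Q : ℕ → ℝ≥0 → Ω → ℝ}
    (hsub : ∀ n, Submartingale (Q n) ℱ P) (h0 : ∀ n t ω, 0 ≤ Q n t ω)
    (hmono : ∀ t ω, Monotone fun n => Q n t ω)
    (hcont : ∀ᵐ ω ∂P, ∀ n, Continuous fun t => Q n t ω) {T : ℝ≥0} {C : ℝ}
    (hC : ∀ n, ∫ ω, Q n T ω ∂P ≤ C) : ∀ᵐ ω ∂P, ∃ B, ∀ n, ∀ t ≤ T, Q n t ω ≤ B := by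
  -- One index `m` governs both the dyadic grid and the term `Q m`. As grids are nested and `Q` is
  -- monotone, `E N m` increases with `m`, so the bound on its probability passes to the union.
  let τ : ℕ → ℕ → ℝ≥0 := fun m i => T * (i / 2 ^ m)
  let E : ℕ → ℕ → Set Ω := fun N m => {ω | ∃ i ≤ 2 ^ m, ((N : ℝ≥0) : ℝ) ≤ Q m (τ m i) ω}
  have hτ : ∀ m, Monotone (τ m) := fun m i j hij => by
    dsimp only [τ]
    gcongr
  have hτT : ∀ m, τ m (2 ^ m) = T := fun m => by simp [τ]
  have hE : ∀ N m, N * P (E N m) ≤ ENNReal.ofReal C := fun N m => by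
    have := mul_measure_exists_le (hsub m) (h0 m) (hτ m) N (2 ^ m)
    rw [hτT] at this
    simpa [E] using this.trans (ENNReal.ofReal_le_ofReal (hC m))
  have hEmono : ∀ N, Monotone (E N) := fun N => by
    refine monotone_nat_of_le_succ fun m => ?_
    rintro ω ⟨i, hi, h⟩
    refine ⟨2 * i, by rw [pow_succ]; omega, h.trans ?_⟩
    have : τ (m + 1) (2 * i) = τ m i := by
      simp only [τ, pow_succ]
      push_cast
      rw [mul_comm (2 : ℝ≥0) i, mul_div_mul_right _ _ two_ne_zero]
    rw [this]
    exact hmono _ _ (Nat.le_succ m)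
  have hU : ∀ N, N * P (⋃ m, E N m) ≤ ENNReal.ofReal C := fun N => by
    rw [(hEmono N).measure_iUnion, ENNReal.mul_iSup]
    exact iSup_le (hE N)
  have hbad : P (⋂ N, ⋃ m, E N m) = 0 := by
    by_contra hne
    obtain ⟨N, hN⟩ := ENNReal.exists_nat_mul_gt hne (ENNReal.ofReal_ne_top (r := C))
    refine absurd hN (not_lt.2 (le_trans ?_ (hU N)))
    gcongr
    exact Set.iInter_subset _ N
  filter_upwards [hcont, measure_eq_zero_iff_ae_notMem.1 hbad] with ω hω hb
  simp only [Set.mem_iInter, Set.mem_iUnion, not_forall, not_exists] at hb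
  obtain ⟨N, hN⟩ := hb
  refine ⟨N, fun n t ht => ?_⟩
  have hx : t / T ≤ 1 := div_le_one_of_le₀ ht (zero_le)
  have htT : T * (t / T) = t := by
    -- For `T = 0` the quotient is `0` by convention, and `t = 0` too.
    rcases eq_or_ne T 0 with h | h
    · subst h
      simpa using (le_antisymm ht (zero_le)).symm
    · field_simp
  have hlim : Filter.Tendsto (fun m : ℕ => τ m ⌊((t / T : ℝ≥0) : ℝ) * 2 ^ m⌋₊)
      Filter.atTop (nhds t) := by
    nth_rw 2 [← htT]
    refine Filter.Tendsto.const_mul T (NNReal.tendsto_coe.1 ?_)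
    have h1 := (tendsto_nat_floor_mul_div_atTop (R := ℝ) (t / T : ℝ≥0).coe_nonneg).comp
      (tendsto_pow_atTop_atTop_of_one_lt (one_lt_two : (1 : ℝ) < 2))
    refine h1.congr fun m => ?_
    simp
  -- For `m ≥ n`, `Q n ≤ Q m < N` at the grid points of level `m`; continuity carries the bound to
  -- `t`.
  refine le_of_tendsto (((hω n).tendsto t).comp hlim) ?_
  filter_upwards [Filter.eventually_ge_atTop n] with m hm
  refine (hmono _ ω hm).trans (not_lt.1 fun hlt =>
    hN m ⟨⌊((t / T : ℝ≥0) : ℝ) * 2 ^ m⌋₊, Nat.floor_le_of_le ?_, by simpa using hlt.le⟩)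
  push_cast
  exact mul_le_of_le_one_left (by positivity) (by exact_mod_cast hx)

lemma submartingale_deterministic {Ω ι : Type*} [Preorder ι] {mΩ : MeasurableSpace Ω}
    {P : Measure Ω} [IsFiniteMeasure P] (ℱ : Filtration ι mΩ) {a : ι → ℝ} (ha : Monotone a) :
    Submartingale (fun t _ => a t) ℱ P :=
  ⟨fun _ => stronglyMeasurable_const, fun i j hij => by
    rw [condExp_const (ℱ.le i)]
    exact ae_of_all _ fun _ => ha hij, fun _ => integrable_const _⟩

lemma submartingale_finsetSum {Ω ι κ : Type*} [Preorder ι] {mΩ : MeasurableSpace Ω}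
    {P : Measure Ω} [IsFiniteMeasure P] {ℱ : Filtration ι mΩ} {f : κ → ι → Ω → ℝ} (s : Finset κ)
    (hf : ∀ k ∈ s, Submartingale (f k) ℱ P) :
    Submartingale (fun t ω => ∑ k ∈ s, f k t ω) ℱ P := by
  classical
  induction s using Finset.induction_on with
  | empty => exact (martingale_zero ℝ ℱ P).submartingale
  | insert k s hk ih =>
    simp only [Finset.sum_insert hk]
    exact (hf k (Finset.mem_insert_self _ _)).add
      (ih fun j hj => hf j (Finset.mem_insert_of_mem hj))

/-! ### Second moments and almost sure membership in `L₂(w)`. -/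

namespace IsLimitMartingale

variable {Ω : Type*} [MeasurableSpace Ω] {P : Measure Ω} [IsProbabilityMeasure P] {α β : ℝ}
  {L : ℕ} {u : ℝ → ℕ → ℝ} {M : ℕ → ℝ≥0 → Ω → ℝ} {w : PosWeight}

lemma integrable_sq (hM : IsLimitMartingale P α β L u M) (k : ℕ) (t : ℝ≥0) :
    Integrable (fun ω => M k t ω ^ 2) P := by
  exact (((hM.bracket k).integrable t).add (integrable_const
    (∫ s in (0 : ℝ)..t, (FPlus α L (u s) k + FMinus β (u s) k)))).congr
    (ae_of_all _ fun ω => sub_add_cancel _ _)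

lemma integral_sq (hM : IsLimitMartingale P α β L u M) (k : ℕ) (t : ℝ≥0) :
    ∫ ω, M k t ω ^ 2 ∂P = ∫ s in (0 : ℝ)..t, (FPlus α L (u s) k + FMinus β (u s) k) := by
  have h := (hM.bracket k).setIntegral_eq (zero_le : 0 ≤ t) MeasurableSet.univ
  simp only [Measure.restrict_univ] at h
  rw [integral_sub (hM.integrable_sq k t) (integrable_const _),
    integral_sub (hM.integrable_sq k 0) (integrable_const _)] at h
  have h0 : ∫ ω, M k 0 ω ^ 2 ∂P = 0 :=
    integral_eq_zero_of_ae ((hM.null_at_zero k).mono fun ω hω => by simp [hω])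
  simp only [h0, NNReal.coe_zero, intervalIntegral.integral_same, integral_const,
    probReal_univ, smul_eq_mul, one_mul, mul_zero, sub_zero] at h
  linarith

/-- The square is a martingale plus its nondecreasing deterministic bracket. -/
lemma submartingale_sq (hM : IsLimitMartingale P α β L u M) (hu : IsMeanFieldSolution α β L u)
    (hα : 0 < α) (hβ : 0 < β) (k : ℕ) :
    Submartingale (fun t ω => M k t ω ^ 2) (jointFiltration M hM.stronglyMeasurable) P := by
  have h1 := (martingale_jointFiltration hM.stronglyMeasurable hM.indep
    (hM.bracket k)).submartingale
  have h2 := h1.add (submartingale_deterministic (P := P)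
    (jointFiltration M hM.stronglyMeasurable)
    (a := fun t : ℝ≥0 => ∫ s in (0 : ℝ)..t, (FPlus α L (u s) k + FMinus β (u s) k))
    fun s t hst => hu.bracket_mono hα hβ k s.coe_nonneg hst)
  refine (congrArg (fun f => Submartingale f _ P) ?_).mp h2
  ext t ω
  simp

/-- The rates vanish at index `0`, hence so does the variance; continuity extends this from a
countable dense set of times. -/
lemma ae_zero_eq_zero (hM : IsLimitMartingale P α β L u M) : ∀ᵐ ω ∂P, ∀ t, M 0 t ω = 0 := by
  have h1 : ∀ t, ∀ᵐ ω ∂P, M 0 t ω = 0 := fun t => by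
    have h := hM.integral_sq 0 t
    simp only [FPlus, FMinus, add_zero, intervalIntegral.integral_zero] at h
    have := (integral_eq_zero_iff_of_nonneg (fun ω => sq_nonneg _) (hM.integrable_sq 0 t)).1 h
    filter_upwards [this] with ω hω
    simpa using hω
  have h2 : ∀ᵐ ω ∂P, ∀ n : ℕ, M 0 (TopologicalSpace.denseSeq ℝ≥0 n) ω = 0 :=
    ae_all_iff.2 fun n => h1 _
  filter_upwards [h2, hM.continuous 0] with ω hω hc t
  have := Continuous.ext_on (TopologicalSpace.denseRange_denseSeq ℝ≥0) hc
    (continuous_const (y := (0 : ℝ))) (by rintro _ ⟨n, rfl⟩; exact hω n)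
  exact congrFun this t

/-- Almost surely `Mₜ ∈ L₂(w)` for all `t ≥ 0`. -/
lemma ae_mem_L2Submodule (hM : IsLimitMartingale P α β L u M) (hu : IsMeanFieldSolution α β L u)
    (hα : 0 < α) (hβ : 0 < β) (hL : 1 ≤ L) (hw : w.Comparable)
    (hu0 : w.EllOneSummable (u 0)) : ∀ᵐ ω ∂P, ∀ t, (fun k => M k t ω) ∈ w.L2Submodule := by
  let Q : ℕ → ℝ≥0 → Ω → ℝ := fun n t ω => ∑ k ∈ Finset.range n, M (k + 1) t ω ^ 2 / w (k + 1)
  have hterm : ∀ k t ω, 0 ≤ M (k + 1) t ω ^ 2 / w (k + 1) := fun k t ω =>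
    div_nonneg (sq_nonneg _) (w.pos_succ k).le
  have hsub : ∀ n, Submartingale (Q n) (jointFiltration M hM.stronglyMeasurable) P := fun n => by
    refine submartingale_finsetSum _ fun k _ => ?_
    refine (congrArg (fun f => Submartingale f _ P) ?_).mp
      ((hM.submartingale_sq hu hα hβ (k + 1)).smul_nonneg (inv_nonneg.2 (w.pos_succ k).le))
    ext t ω
    simp [div_eq_inv_mul]
  have hcont : ∀ᵐ ω ∂P, ∀ n, Continuous fun t => Q n t ω := by
    filter_upwards [ae_all_iff.2 hM.continuous] with ω hω n
    exact continuous_finsetSum _ fun k _ => ((hω (k + 1)).pow 2).div_const _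
  have hB : ∀ T : ℕ, ∀ᵐ ω ∂P, ∃ B, ∀ n, ∀ t ≤ (T : ℝ≥0), Q n t ω ≤ B := fun T => by
    obtain ⟨C, hC⟩ := hu.exists_sum_bracket_le hα hβ hL hw hu0 (T : ℝ≥0).coe_nonneg
    refine ae_exists_forall_le_of_submartingale hsub
      (fun n t ω => Finset.sum_nonneg fun k _ => hterm k t ω)
      (fun t ω => monotone_nat_of_le_succ fun n => ?_) hcont (C := C) fun n => ?_
    · simp only [Q, Finset.sum_range_succ]
      exact le_add_of_nonneg_right (hterm n t ω)
    · simp only [Q]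
      rw [integral_finsetSum _ fun k _ => (hM.integrable_sq (k + 1) T).div_const _]
      simp_rw [integral_div, hM.integral_sq]
      exact hC n
  filter_upwards [hM.ae_zero_eq_zero, ae_all_iff.2 hB] with ω h0 hω t
  refine ⟨h0 t, ?_⟩
  obtain ⟨T, hT⟩ := exists_nat_ge t
  obtain ⟨B, hB⟩ := hω T
  exact summable_of_sum_range_le (fun k => hterm k t ω) fun n => hB n t hT

end IsLimitMartingale

/-! ### Coordinates, measurability and martingales in `L₂(w)`. -/

namespace PosWeight.L2

variable {w : PosWeight}

@[ext]
lemma ext {x y : w.L2} (h : ∀ k, x k = y k) : x = y := Subtype.ext (funext h)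

lemma abs_apply_succ_le (x : w.L2) (k : ℕ) : |x (k + 1)| ≤ √(w (k + 1)) * ‖x‖ := by
  refine abs_le_of_sq_le_sq ?_ (by positivity)
  rw [mul_pow, Real.sq_sqrt (w.pos_succ k).le, norm_sq_eq, ← div_le_iff₀' (w.pos_succ k)]
  exact x.summable_sq.le_tsum k fun j _ => div_nonneg (sq_nonneg _) (w.pos_succ j).le

/-- The coordinate functional `x ↦ x(k+1)`. -/
noncomputable def coordSucc (w : PosWeight) (k : ℕ) : w.L2 →L[ℝ] ℝ :=
  LinearMap.mkContinuous
    { toFun := fun x => x (k + 1)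
      map_add' := fun x y => add_apply x y (k + 1)
      map_smul' := fun a x => smul_apply a x (k + 1) }
    (√(w (k + 1))) fun x => x.abs_apply_succ_le k

@[simp]
lemma coordSucc_apply (k : ℕ) (x : w.L2) : coordSucc w k x = x (k + 1) := rfl

/-- The sequence equal to `1` at `k + 1` and to `0` elsewhere. -/
noncomputable def basisVec (w : PosWeight) (k : ℕ) : w.L2 :=
  ⟨Pi.single (k + 1) 1, by simp, summable_of_ne_finset_zero (s := {k}) fun j hj => by
    have : j ≠ k := by simpa using hj
    simp [this]⟩

lemma basisVec_apply_succ (k j : ℕ) :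
    basisVec w k (j + 1) = if j = k then 1 else 0 := by
  simp [basisVec, Pi.single_apply]

lemma sum_smul_basisVec_apply_succ (x : w.L2) (n j : ℕ) :
    (∑ k ∈ Finset.range n, x (k + 1) • basisVec w k) (j + 1) = if j < n then x (j + 1) else 0 := by
  rw [← coordSucc_apply, map_sum]
  simp [basisVec_apply_succ]

lemma tendsto_sum_smul_basisVec (x : w.L2) :
    Filter.Tendsto (fun n => ∑ k ∈ Finset.range n, x (k + 1) • basisVec w k) Filter.atTop
      (nhds x) := by
  rw [tendsto_iff_norm_sub_tendsto_zero]
  have hsq : ∀ n, ‖∑ k ∈ Finset.range n, x (k + 1) • basisVec w k - x‖ ^ 2 =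
      ∑' k, x (k + n + 1) ^ 2 / w (k + n + 1) := fun n => by
    have hc : ∀ j, (∑ k ∈ Finset.range n, x (k + 1) • basisVec w k - x) (j + 1) =
        if j < n then 0 else -x (j + 1) := fun j => by
      rw [← coordSucc_apply, map_sub, coordSucc_apply, coordSucc_apply,
        sum_smul_basisVec_apply_succ]
      split_ifs <;> simp
    rw [norm_sq_eq, ← (summable_sq _).sum_add_tsum_nat_add n]
    simp only [hc]
    rw [Finset.sum_eq_zero fun k hk => by simp [Finset.mem_range.1 hk], zero_add]
    exact tsum_congr fun k => by simp
  have h := (tendsto_sum_nat_add fun k => x (k + 1) ^ 2 / w (k + 1)).sqrt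
  rw [Real.sqrt_zero] at h
  refine h.congr fun n => ?_
  rw [← hsq n, Real.sqrt_sq (norm_nonneg _)]

open Classical in
/-- A sequence of `L₂(w)` as an element of this space; `0` if it is not in `L₂(w)`. -/
noncomputable def ofSeq (w : PosWeight) (x : ℕ → ℝ) : w.L2 :=
  if h : x ∈ w.L2Submodule then ⟨x, h⟩ else 0

lemma ofSeq_apply {x : ℕ → ℝ} (h : x ∈ w.L2Submodule) (k : ℕ) : ofSeq w x k = x k :=
  congrArg (fun y : w.L2 => y k) (dif_pos h)

lemma ofSeq_of_notMem {x : ℕ → ℝ} (h : x ∉ w.L2Submodule) : ofSeq w x = 0 := dif_neg h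

end PosWeight.L2

namespace PosWeight

variable {w : PosWeight}

/-- Writes summability with countable quantifiers only, for measurability. -/
lemma summable_iff_exists_nat (x : ℕ → ℝ) :
    (Summable fun k => x (k + 1) ^ 2 / w (k + 1)) ↔
      ∃ N : ℕ, ∀ n, ∑ k ∈ Finset.range n, x (k + 1) ^ 2 / w (k + 1) ≤ N := by
  have h0 : ∀ k, 0 ≤ x (k + 1) ^ 2 / w (k + 1) := fun k =>
    div_nonneg (sq_nonneg _) (w.pos_succ k).le
  constructor
  · intro h
    obtain ⟨N, hN⟩ := exists_nat_ge (∑' k, x (k + 1) ^ 2 / w (k + 1))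
    exact ⟨N, fun n => (h.sum_le_tsum _ fun k _ => h0 k).trans hN⟩
  · rintro ⟨N, hN⟩
    exact summable_of_sum_range_le h0 hN

lemma measurableSet_mem_L2Submodule {Ω : Type*} {m : MeasurableSpace Ω} {Y : ℕ → Ω → ℝ}
    (hY : ∀ k, Measurable (Y k)) : MeasurableSet {ω | (fun k => Y k ω) ∈ w.L2Submodule} := by
  have : {ω | (fun k => Y k ω) ∈ w.L2Submodule} = {ω | Y 0 ω = 0} ∩
      ⋃ N : ℕ, ⋂ n, {ω | ∑ k ∈ Finset.range n, Y (k + 1) ω ^ 2 / w (k + 1) ≤ N} := by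
    ext ω
    simp only [Set.mem_inter_iff, Set.mem_iUnion, Set.mem_iInter, Set.mem_ofPred_eq]
    exact and_congr_right fun _ => summable_iff_exists_nat fun k => Y k ω
  rw [this]
  refine (measurableSet_eq_fun (hY 0) measurable_const).inter
    (.iUnion fun N => .iInter fun n => measurableSet_le ?_ measurable_const)
  exact Finset.measurable_fun_sum _ fun k _ => ((hY (k + 1)).pow_const 2).div_const _

namespace L2

/-- Pointwise limit of finite truncations. The event where `ofSeq` defaults to `0` lies in `m`
itself, so adaptedness needs no completion of the filtration. -/
lemma stronglyMeasurable_ofSeq {Ω : Type*} {m : MeasurableSpace Ω} {Y : ℕ → Ω → ℝ}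
    (hY : ∀ k, Measurable (Y k)) : StronglyMeasurable fun ω => ofSeq w fun k => Y k ω := by
  have hc : ∀ k, StronglyMeasurable fun ω => ofSeq w (fun k => Y k ω) (k + 1) := fun k => by
    have : (fun ω => ofSeq w (fun k => Y k ω) (k + 1)) =
        {ω | (fun k => Y k ω) ∈ w.L2Submodule}.indicator (Y (k + 1)) := by
      ext ω
      by_cases h : (fun k => Y k ω) ∈ w.L2Submodule
      · rw [ofSeq_apply h, Set.indicator_of_mem (by exact h)]
      · rw [ofSeq_of_notMem h, Set.indicator_of_notMem (by exact h)]
        rfl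
    rw [this]
    exact ((hY (k + 1)).indicator (measurableSet_mem_L2Submodule hY)).stronglyMeasurable
  refine stronglyMeasurable_of_tendsto Filter.atTop
    (f := fun n ω => ∑ k ∈ Finset.range n, ofSeq w (fun k => Y k ω) (k + 1) • basisVec w k)
    (fun n => Finset.stronglyMeasurable_fun_sum _ fun k _ => (hc k).smul_const _)
    (tendsto_pi_nhds.2 fun ω => tendsto_sum_smul_basisVec _)

/-- A random element of `L₂(w)` whose coordinates have summable weighted second moments is
square integrable. -/
lemma memLp_two_of_summable {Ω : Type*} {mΩ : MeasurableSpace Ω} {P : Measure Ω} {X : Ω → w.L2}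
    (hX : AEStronglyMeasurable X P) (hi : ∀ k, Integrable (fun ω => X ω (k + 1) ^ 2) P)
    (hs : Summable fun k => (∫ ω, X ω (k + 1) ^ 2 ∂P) / w (k + 1)) : MemLp X 2 P := by
  rw [memLp_two_iff_integrable_sq_norm hX]
  refine ⟨hX.norm.pow 2, ?_⟩
  have h0 : ∀ k ω, 0 ≤ X ω (k + 1) ^ 2 / w (k + 1) := fun k ω =>
    div_nonneg (sq_nonneg _) (w.pos_succ k).le
  have h1 : ∀ ω, ‖‖X ω‖ ^ 2‖ₑ = ∑' k, ENNReal.ofReal (X ω (k + 1) ^ 2 / w (k + 1)) := fun ω => by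
    rw [Real.enorm_of_nonneg (sq_nonneg _), norm_sq_eq,
      ENNReal.ofReal_tsum_of_nonneg (fun k => h0 k ω) (X ω).summable_sq]
  rw [hasFiniteIntegral_iff_enorm]
  simp_rw [h1]
  rw [lintegral_tsum fun k => ((hi k).div_const _).aemeasurable.ennreal_ofReal]
  simp_rw [← ofReal_integral_eq_lintegral_ofReal ((hi _).div_const _) (ae_of_all _ (h0 _)),
    integral_div]
  rw [← ENNReal.ofReal_tsum_of_nonneg (fun k => div_nonneg
    (integral_nonneg fun ω => sq_nonneg _) (w.pos_succ k).le) hs]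
  exact ENNReal.ofReal_lt_top

/-- A process in `L₂(w)` is a martingale if its coordinates are. -/
lemma martingale_of_coord {Ω ι : Type*} [Preorder ι] {mΩ : MeasurableSpace Ω} {P : Measure Ω}
    {ℱ : Filtration ι mΩ} {X : ι → Ω → w.L2} (hX : StronglyAdapted ℱ X)
    (hi : ∀ t, Integrable (X t) P)
    (hc : ∀ k, Martingale (fun t ω => X t ω (k + 1)) ℱ P) : Martingale X ℱ P := by
  refine ⟨hX, fun s t hst => ?_⟩
  -- Conditional expectation commutes with continuous functionals, and countably many coordinates
  -- separate points.
  have h : ∀ k, (fun ω => coordSucc w k ((P[X t | ℱ s]) ω)) =ᵐ[P] fun ω => X s ω (k + 1) :=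
    fun k => ((coordSucc w k).comp_condExp_comm (hi t)).trans ((hc k).condExp_ae_eq hst)
  filter_upwards [ae_all_iff.2 h] with ω hω
  ext k
  cases k with
  | zero => rw [apply_zero, apply_zero]
  | succ k => exact hω k

end L2

end PosWeight

theorem mainTheorem4 {Ω : Type*} [MeasurableSpace Ω] (P : Measure Ω) [IsProbabilityMeasure P]
    (α β : ℝ) (hα : 0 < α) (hβ : 0 < β) (L : ℕ) (hL : 1 ≤ L)
    (w : PosWeight) (hw : w.Comparable)
    (u : ℝ → ℕ → ℝ) (hu : IsMeanFieldSolution α β L u) (hu0 : w.EllOneSummable (u 0))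
    (M : ℕ → ℝ≥0 → Ω → ℝ) (hM : IsLimitMartingale P α β L u M) :
    ∃ X : ℝ≥0 → Ω → w.L2,
      (∀ᵐ ω ∂P, ∀ t k, X t ω k = M k t ω) ∧
      Martingale X (jointFiltration M hM.stronglyMeasurable) P ∧
      ∀ t, MemLp (X t) 2 P := by
  let X : ℝ≥0 → Ω → w.L2 := fun t ω => PosWeight.L2.ofSeq w fun k => M k t ω
  have hXM : ∀ᵐ ω ∂P, ∀ t k, X t ω k = M k t ω := by
    filter_upwards [hM.ae_mem_L2Submodule hu hα hβ hL hw hu0] with ω hω t k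
    exact PosWeight.L2.ofSeq_apply (hω t) k
  have hadapt : StronglyAdapted (jointFiltration M hM.stronglyMeasurable) X := fun t =>
    PosWeight.L2.stronglyMeasurable_ofSeq fun k =>
      (stronglyMeasurable_jointFiltration hM.stronglyMeasurable k t).measurable
  have hcoord : ∀ k t, (fun ω => X t ω k) =ᵐ[P] M k t := fun k t =>
    hXM.mono fun ω hω => hω t k
  have hsq : ∀ k t, (fun ω => M k t ω ^ 2) =ᵐ[P] fun ω => X t ω k ^ 2 := fun k t =>
    (hcoord k t).symm.mono fun ω hω => congrArg (· ^ 2) hω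
  have hmem : ∀ t, MemLp (X t) 2 P := fun t => by
    refine PosWeight.L2.memLp_two_of_summable
      ((hadapt t).mono ((jointFiltration M hM.stronglyMeasurable).le t)).aestronglyMeasurable
      (fun k => (hM.integrable_sq (k + 1) t).congr (hsq _ t)) ?_
    obtain ⟨C, hC⟩ := hu.exists_sum_bracket_le hα hβ hL hw hu0 t.coe_nonneg
    simp_rw [← integral_congr_ae (hsq _ t), hM.integral_sq]
    refine summable_of_sum_range_le (fun k => div_nonneg ?_ (w.pos_succ k).le) hC
    exact intervalIntegral.integral_nonneg t.coe_nonneg fun s hs =>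
      hu.rate_nonneg hα hβ _ hs.1
  refine ⟨X, hXM, PosWeight.L2.martingale_of_coord hadapt
    (fun t => (hmem t).integrable one_le_two) fun k => ?_, hmem⟩
  refine (martingale_jointFiltration hM.stronglyMeasurable hM.indep
    (hM.martingale (k + 1))).congr (fun t => ?_) fun t => (hcoord (k + 1) t).symm
  exact (PosWeight.L2.coordSucc w k).continuous.comp_stronglyMeasurable (hadapt t)
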